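/- **Proposition 2.5.** Let $X\neq\{0\}$ be a real Banach space with dual $X^*$. For a set-valued operator $T:X\rightrightarrows X^*$ write $G(T)=\{(x,x^*): x^*\in T(x)\}$. $T$ is monotone if $\langle x^*-y^*,x-y\rangle\ge 0$ for all $(x,x^*),(y,y^*)\in G(T)$, maximal monotone if it is monotone and no monotone operator has a graph strictly containing $G(T)$, and bounded if its range $\bigcup_{x\in X}T(x)$ is a norm-bounded subset of $X^*$. The sum of two operators is $(T+S)(x)=\{t^*+s^*: t^*\in T(x),\ s^*\in S(x)\}$. For $(x,x^*)\in X\times X^*$ put $$L(x,x^*,T)=\sup\Big(\{0\}\cup\Big\{\frac{\langle y^*-x^*,x-y\rangle}{\|x-y\|}: (y,y^*)\in G(T),\ y\ne x\Big\}\Big)\in[0,\infty].$$ A maximal monotone operator $T$ is called regular if $L(x,x^*,T)=d(x^*,T(x))$ for all $(x,x^*)\in X\times X^*$, where $d(x^*,A)=\inf_{a^*\in A}\|x^*-a^*\|$ and $d(x^*,\emptyset)=\infty$. Let $T:X\rightrightarrows X^*$ be maximal monotone. Then $T$ is regular if and only if, for every bounded maximal monotone operator $S:X\rightrightarrows X^*$,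 the operator $T+S$ is maximal monotone and regular. -/

import Mathlib

open scoped Pointwise

/-- The graph of a set-valued operator `T : X ⇉ X*`. -/
def opGraph {X : Type*} [NormedAddCommGroup X] [NormedSpace ℝ X]
    (T : X → Set (StrongDual ℝ X)) : Set (X × StrongDual ℝ X) :=
  {p | p.2 ∈ T p.1}

/-- The range of a set-valued operator. -/
def opRange {X : Type*} [NormedAddCommGroup X] [NormedSpace ℝ X]
    (T : X → Set (StrongDual ℝ X)) : Set (StrongDual ℝ X) :=
  {xs | ∃ x, xs ∈ T x}

/-- Monotonicity: `⟨x* - y*, x - y⟩ ≥ 0` for all `(x, x*)`, `(y, y*)` in the graph. -/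
def IsMonotoneOp {X : Type*} [NormedAddCommGroup X] [NormedSpace ℝ X]
    (T : X → Set (StrongDual ℝ X)) : Prop :=
  ∀ p ∈ opGraph T, ∀ q ∈ opGraph T, 0 ≤ (p.2 - q.2) (p.1 - q.1)

/-- Maximal monotonicity: no monotone operator has a strictly larger graph. -/
def IsMaximalMonotoneOp {X : Type*} [NormedAddCommGroup X] [NormedSpace ℝ X]
    (T : X → Set (StrongDual ℝ X)) : Prop :=
  IsMonotoneOp T ∧ ¬ ∃ S : X → Set (StrongDual ℝ X), IsMonotoneOp S ∧ opGraph T ⊂ opGraph S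

/-- A bounded operator is one whose range is a norm-bounded subset of the dual. -/
def IsBoundedOp {X : Type*} [NormedAddCommGroup X] [NormedSpace ℝ X]
    (T : X → Set (StrongDual ℝ X)) : Prop :=
  Bornology.IsBounded (opRange T)

/-- `L(x, x*, T) = sup {⟨y* - x*, x - y⟩ / ‖x - y‖ : y ≠ x, (y, y*) ∈ G(T)}`, the supremum being
taken in `[0, ∞]`: negative quotients count as `0`, and the supremum of the empty family is `0`. -/
noncomputable def opL {X : Type*} [NormedAddCommGroup X] [NormedSpace ℝ X]
    (x : X) (xs : StrongDual ℝ X) (T : X → Set (StrongDual ℝ X)) : ENNReal :=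
  ⨆ p ∈ {p ∈ opGraph T | p.1 ≠ x}, ENNReal.ofReal ((p.2 - xs) (x - p.1) / ‖x - p.1‖)

/-- Regularity of a (maximal monotone) operator: `L(x, x*, T) = d(x*, T(x))` for all `(x, x*)`;
the distance is that of the dual norm, and the distance to the empty set is `∞`. -/
def IsRegularOp {X : Type*} [NormedAddCommGroup X] [NormedSpace ℝ X]
    (T : X → Set (StrongDual ℝ X)) : Prop :=
  ∀ (x : X) (xs : StrongDual ℝ X), opL x xs T = Metric.infEDist xs (T x)

/-!
The implication from right to left is the case `S = 0`. For the converse, let `T` be regular, `S`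
bounded and maximal monotone, and suppose `L(x, x*, T + S) ≤ M < ∞`. After a translation
`(x, x*) = (0, 0)`, so that `⟨y* + s, y⟩ + M‖y‖ ≥ 0` for all `y* ∈ T y`, `s ∈ S y`. It suffices to find
`s₀ ∈ S 0` with `⟨y* + s₀, y⟩ + M‖y‖ ≥ 0` on the graph of `T`: regularity of `T` at `(0, -s₀)` then gives
`d(-s₀, T 0) ≤ M`, hence `d(0, T 0 + S 0) ≤ M`. For `M = 0` maximality of `T` even gives
`-s₀ ∈ T 0`, which is what maximality of `T + S` requires.

By maximality of `S`, the functional `s₀` only has to satisfy the linear inequalities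
`⟨s₀, w⟩ ≤ ⟨s, w⟩` on the graph of `S` and `⟨s₀, -y⟩ ≤ ⟨y*, y⟩ + M‖y‖` on that of `T`. By Hahn–Banach
(`exists_linearMap_le_of_convexCone`) this is possible once a convex cone containing these
constraints has no element `(0, r)` with `r < 0`; this is `add_add_norm_nonneg_of_related`.
If there were such an element, given by a point `v` and functionals `t`, `s` in the Fitzpatrick-type
inequalities for `T` and `S`, then for small `τ > 0` the point `(τ v, τ (t + s))` would be related to
`T + S` with a strictly positive slack. As `S` is bounded, `L(τ v, ·, T)` is then finite, so
regularity puts `τ v` in the domain of `T`, and testing the slack at `y = τ v` is a contradiction.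

The argument needs that a bounded maximal monotone operator has full domain, which is the same
Hahn–Banach principle applied to the cone generated by its graph
(`exists_le_of_monotone_of_bounded`).
-/

/-! ### Linear functions below convex cones -/

section ConvexCone

variable {X : Type*} [NormedAddCommGroup X] [NormedSpace ℝ X]

/-- A form of the Riesz extension theorem for convex cones in `E × ℝ`, read as "epigraphs": if the
cone projects onto `E` and meets the axis `{0} × ℝ` only in nonnegative heights, then some linear
function lies below it. -/
theorem exists_linearMap_le_of_convexCone {E : Type*} [AddCommGroup E] [Module ℝ E]
    (C : ConvexCone ℝ (E × ℝ)) (h0 : ∀ r, ((0 : E), r) ∈ C → 0 ≤ r)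
    (hd : ∀ d, ∃ r, (d, r) ∈ C) :
    ∃ f : E →ₗ[ℝ] ℝ, ∀ d r, (d, r) ∈ C → f d ≤ r := by
  let W : Submodule ℝ (E × ℝ) := LinearMap.ker (LinearMap.fst ℝ E ℝ)
  let φ : (E × ℝ) →ₗ.[ℝ] ℝ := ⟨W, (LinearMap.snd ℝ E ℝ).comp W.subtype⟩
  have hmem : ∀ r : ℝ, ((0 : E), r) ∈ φ.domain := fun r => by
    change ((0 : E), r) ∈ W
    simp [W]
  let C₀ : ConvexCone ℝ (E × ℝ) :=
    { carrier := {z | z = 0 ∨ z ∈ C}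
      smul_mem' := by
        rintro c hc z (rfl | hz)
        · exact Or.inl (smul_zero c)
        · exact Or.inr (C.smul_mem hc hz)
      add_mem' := by
        rintro z (rfl | hz) z' (rfl | hz')
        · exact Or.inl (add_zero 0)
        · exact Or.inr (by rwa [zero_add])
        · exact Or.inr (by rwa [add_zero])
        · exact Or.inr (C.add_mem hz hz') }
  obtain ⟨g, hg, hgC⟩ := riesz_extension (C₀.toPointedCone (Or.inl rfl)) φ
    (by
      rintro ⟨⟨d, r⟩, hx⟩ (hC | hC)
      · exact (congrArg Prod.snd hC).ge
      · have hd0 : d = 0 := by simpa [φ, W] using hx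
        subst hd0
        exact h0 r hC)
    (by
      rintro ⟨d, r₀⟩
      obtain ⟨r, hr⟩ := hd d
      refine ⟨⟨(0, r - r₀), hmem _⟩, Or.inr ?_⟩
      simpa using hr)
  refine ⟨-(g.comp (LinearMap.inl ℝ E ℝ)), fun d r hC => ?_⟩
  have h1 : g (0, r) = r := hg ⟨(0, r), hmem r⟩
  have h2 : g (d, r) = g (d, 0) + g (0, r) := by rw [← map_add]; simp
  have h3 : 0 ≤ g (d, r) := hgC _ (Or.inr hC)
  change -g (d, 0) ≤ r
  linarith

theorem exists_strongDual_of_le_norm (f : X →ₗ[ℝ] ℝ) (K : ℝ) (h : ∀ d, f d ≤ K * ‖d‖) :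
    ∃ g : StrongDual ℝ X, ∀ d, g d = f d := by
  refine ⟨f.mkContinuous K fun d => ?_, fun d => rfl⟩
  have h1 := h (-d)
  rw [map_neg, norm_neg] at h1
  rw [Real.norm_eq_abs, abs_le]
  exact ⟨by linarith, h d⟩

end ConvexCone

/-! ### Systems of linear inequalities given by monotone sets -/

section Monotone

variable {X : Type*} [NormedAddCommGroup X] [NormedSpace ℝ X]

/-- A monotone set with bounded second coordinates extends, as a monotone set, by a point over `0`.
Quadruples `(v, s, α, N)` in the cone generated by `(y, y*, ⟨y*, y⟩, 1)` satisfy `⟨s, v⟩ ≤ N α`, by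
monotonicity, and `‖s‖ ≤ K N`, whence `α ≥ -K ‖v‖`; this makes Hahn–Banach applicable. -/
theorem exists_le_of_monotone_of_bounded (B : Set (X × StrongDual ℝ X)) (hne : B.Nonempty)
    (hB : ∀ p ∈ B, ∀ q ∈ B, 0 ≤ (p.2 - q.2) (p.1 - q.1)) (K : ℝ) (hK : ∀ p ∈ B, ‖p.2‖ ≤ K) :
    ∃ s₀ : StrongDual ℝ X, ∀ p ∈ B, s₀ p.1 ≤ p.2 p.1 := by
  let gen : Set (X × StrongDual ℝ X × ℝ × ℝ) := (fun p => (p.1, p.2, p.2 p.1, 1)) '' B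
  let P := ConvexCone.hull ℝ gen
  have hK0 : 0 ≤ K := (norm_nonneg _).trans (hK _ hne.some_mem)
  have hP : ∀ p ∈ P, 0 < p.2.2.2 ∧ ‖p.2.1‖ ≤ K * p.2.2.2 := by
    let Q : ConvexCone ℝ (X × StrongDual ℝ X × ℝ × ℝ) :=
      { carrier := {p | 0 < p.2.2.2 ∧ ‖p.2.1‖ ≤ K * p.2.2.2}
        smul_mem' := by
          rintro c hc p ⟨h1, h2⟩
          refine ⟨mul_pos hc h1, ?_⟩
          change ‖c • p.2.1‖ ≤ K * (c * p.2.2.2)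
          rw [norm_smul, Real.norm_of_nonneg hc.le]
          nlinarith
        add_mem' := by
          rintro p ⟨h1, h2⟩ q ⟨h3, h4⟩
          refine ⟨add_pos h1 h3, ?_⟩
          change ‖p.2.1 + q.2.1‖ ≤ K * (p.2.2.2 + q.2.2.2)
          linarith [norm_add_le p.2.1 q.2.1] }
    refine ConvexCone.hull_min (C := Q) ?_
    rintro _ ⟨p, hp, rfl⟩
    exact ⟨one_pos, by simpa using hK p hp⟩
  -- `p ∈ pol q` is a symmetric bilinear condition on `p` and `q`. On two generators it says
  -- `0 ≤ ⟨p* - q*, p - q⟩`, and it passes to the generated cone in each variable separately.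
  let pol (q : X × StrongDual ℝ X × ℝ × ℝ) : ConvexCone ℝ (X × StrongDual ℝ X × ℝ × ℝ) :=
    { carrier := {p | 0 ≤ q.2.2.2 * p.2.2.1 + p.2.2.2 * q.2.2.1 - p.2.1 q.1 - q.2.1 p.1}
      smul_mem' := by
        intro c hc p hp
        have := mul_nonneg hc.le
          (show 0 ≤ q.2.2.2 * p.2.2.1 + p.2.2.2 * q.2.2.1 - p.2.1 q.1 - q.2.1 p.1 from hp)
        simp only [Set.mem_ofPred_eq, Prod.smul_fst, Prod.smul_snd, smul_eq_mul,
          smul_apply, map_smul]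
        linarith
      add_mem' := by
        intro p hp p' hp'
        have h1 : 0 ≤ q.2.2.2 * p.2.2.1 + p.2.2.2 * q.2.2.1 - p.2.1 q.1 - q.2.1 p.1 := hp
        have h2 : 0 ≤ q.2.2.2 * p'.2.2.1 + p'.2.2.2 * q.2.2.1 - p'.2.1 q.1 - q.2.1 p'.1 := hp'
        simp only [Set.mem_ofPred_eq, Prod.fst_add, Prod.snd_add,
          add_apply, map_add]
        linarith }
  have hpol1 : ∀ q ∈ gen, ∀ p ∈ P, p ∈ pol q := by
    rintro _ ⟨q, hq, rfl⟩
    refine ConvexCone.hull_min (C := pol _) ?_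
    rintro _ ⟨p, hp, rfl⟩
    have := hB p hp q hq
    simp only [sub_apply, map_sub] at this
    change 0 ≤ 1 * p.2 p.1 + 1 * q.2 q.1 - p.2 q.1 - q.2 p.1
    linarith
  have hpol : ∀ q ∈ P, ∀ p ∈ P, p ∈ pol q := by
    intro q hq p hp
    have : q ∈ pol p := by
      refine ConvexCone.hull_min (C := pol p) ?_ hq
      intro q' hq'
      have : 0 ≤ q'.2.2.2 * p.2.2.1 + p.2.2.2 * q'.2.2.1 - p.2.1 q'.1 - q'.2.1 p.1 :=
        hpol1 q' hq' p hp
      change 0 ≤ p.2.2.2 * q'.2.2.1 + q'.2.2.2 * p.2.2.1 - q'.2.1 p.1 - p.2.1 q'.1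
      linarith
    have : 0 ≤ p.2.2.2 * q.2.2.1 + q.2.2.2 * p.2.2.1 - q.2.1 p.1 - p.2.1 q.1 := this
    change 0 ≤ q.2.2.2 * p.2.2.1 + p.2.2.2 * q.2.2.1 - p.2.1 q.1 - q.2.1 p.1
    linarith
  have hgen : ∀ p ∈ B, (p.1, p.2, p.2 p.1, (1 : ℝ)) ∈ P := fun p hp =>
    ConvexCone.subset_hull (Set.mem_image_of_mem _ hp)
  -- The term `K * ‖z.1 - p.1‖` makes the cone project onto `X` and bounds the functional by `K`.
  let C : ConvexCone ℝ (X × ℝ) :=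
    { carrier := {z | ∃ p ∈ P, p.2.2.1 + K * ‖z.1 - p.1‖ ≤ z.2}
      smul_mem' := by
        rintro c hc z ⟨p, hp, h⟩
        refine ⟨c • p, P.smul_mem hc hp, ?_⟩
        change c * p.2.2.1 + K * ‖c • z.1 - c • p.1‖ ≤ c * z.2
        rw [← smul_sub, norm_smul, Real.norm_of_nonneg hc.le]
        nlinarith
      add_mem' := by
        rintro z ⟨p, hp, h⟩ z' ⟨p', hp', h'⟩
        refine ⟨p + p', P.add_mem hp hp', ?_⟩
        change p.2.2.1 + p'.2.2.1 + K * ‖z.1 + z'.1 - (p.1 + p'.1)‖ ≤ z.2 + z'.2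
        rw [add_sub_add_comm]
        nlinarith [norm_add_le (z.1 - p.1) (z'.1 - p'.1)] }
  obtain ⟨f, hf⟩ := exists_linearMap_le_of_convexCone C
    (by
      rintro r ⟨⟨v, s, α, N⟩, hp, h⟩
      obtain ⟨hN, hs⟩ := hP _ hp
      -- The bilinear condition on the diagonal.
      have h1 : 0 ≤ N * α + N * α - s v - s v := hpol _ hp _ hp
      simp only [zero_sub, norm_neg] at h hN hs
      have h2 := (abs_le.1 (s.le_opNorm v)).1
      have h3 : 0 ≤ N * (α + K * ‖v‖) := by nlinarith [norm_nonneg v]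
      exact (nonneg_of_mul_nonneg_right h3 hN).trans h)
    (fun d => ⟨hne.some.2 hne.some.1 + K * ‖d - hne.some.1‖, _, hgen _ hne.some_mem, le_rfl⟩)
  have hfB : ∀ p ∈ B, f p.1 ≤ p.2 p.1 := fun p hp => hf _ _ ⟨_, hgen p hp, by simp⟩
  obtain ⟨p, hp⟩ := hne
  -- `(d, K ‖d‖)` need not lie in the cone, since `0` need not lie in `P`; it is the limit of the
  -- elements `(d, ε ⟨p*, p⟩ + K ‖d - ε p‖)` as `ε → 0`.
  have hfK : ∀ d, f d ≤ K * ‖d‖ := by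
    intro d
    have key : ∀ ε : ℝ, 0 < ε → f d ≤ ε * p.2 p.1 + K * ‖d - ε • p.1‖ := fun ε hε =>
      hf _ _ ⟨_, P.smul_mem hε (hgen p hp), le_rfl⟩
    have hcont : Continuous fun ε : ℝ => ε * p.2 p.1 + K * ‖d - ε • p.1‖ := by fun_prop
    have hlim := (hcont.tendsto 0).mono_left (nhdsWithin_le_nhds (s := Set.Ioi 0))
    simp only [zero_mul, zero_smul, sub_zero, zero_add] at hlim
    exact ge_of_tendsto hlim (Filter.eventually_of_mem self_mem_nhdsWithin key)
  obtain ⟨g, hg⟩ := exists_strongDual_of_le_norm f K hfK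
  exact ⟨g, fun p hp => (hg _).trans_le (hfB p hp)⟩

/-- The heart of the argument. The hypotheses `h1` and `h2` say that `α / N` and `β / N` bound the
Fitzpatrick functions of `A` at `(v / N, t / N)` and of `B` at `(v / N, s / N)`. If
`α + β + M ‖v‖` were negative, a small multiple `(τ v, τ (t + s))` would be strictly related to the
sum of `A` and `B`, which `hAreg` (the form of regularity used here: a point with finite `L` lies in
the domain) rules out. -/
theorem add_add_norm_nonneg_of_related (A B : Set (X × StrongDual ℝ X)) (M K : ℝ) (hM : 0 ≤ M)
    (hBK : ∀ p ∈ B, ‖p.2‖ ≤ K) (hBdom : ∀ x, ∃ s, (x, s) ∈ B)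
    (hAreg : ∀ x xs C, (∀ p ∈ A, -(C * ‖p.1 - x‖) ≤ (p.2 - xs) (p.1 - x)) → ∃ z, (x, z) ∈ A)
    (hAB : ∀ y ys s, (y, ys) ∈ A → (y, s) ∈ B → -(M * ‖y‖) ≤ (ys + s) y)
    {v : X} {t s : StrongDual ℝ X} {α β N : ℝ} (hN : 0 < N)
    (h1 : ∀ p ∈ A, t p.1 + p.2 v ≤ α + N * p.2 p.1)
    (h2 : ∀ p ∈ B, s p.1 + p.2 v ≤ β + N * p.2 p.1) : 0 ≤ α + β + M * ‖v‖ := by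
  by_contra! hneg
  obtain ⟨τ, hτ, hτN, hτδ⟩ : ∃ τ : ℝ, 0 < τ ∧ τ * N ≤ 1 ∧
      0 < -(α + β + M * ‖v‖) + τ * (t + s) v := by
    have hcont : Continuous fun τ : ℝ => -(α + β + M * ‖v‖) + τ * (t + s) v := by fun_prop
    have e1 : ∀ᶠ τ : ℝ in nhdsWithin 0 (Set.Ioi 0),
        0 < -(α + β + M * ‖v‖) + τ * (t + s) v :=
      nhdsWithin_le_nhds ((hcont.tendsto 0).eventually
        (lt_mem_nhds (by simpa only [zero_mul, add_zero, neg_pos] using hneg)))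
    have hcont' : Continuous fun τ : ℝ => τ * N := by fun_prop
    have e2 : ∀ᶠ τ : ℝ in nhdsWithin 0 (Set.Ioi 0), τ * N < 1 :=
      nhdsWithin_le_nhds ((hcont'.tendsto 0).eventually (gt_mem_nhds (by simp)))
    obtain ⟨τ, h, h', h''⟩ := (e1.and (e2.and self_mem_nhdsWithin)).exists
    exact ⟨τ, h'', h'.le, h⟩
  -- Combination of `h1 + h2`, weighted by `τ`, with `hAB`, weighted by `1 - τ N`.
  have key : ∀ y ys s', (y, ys) ∈ A → (y, s') ∈ B →
      M * (τ * ‖v‖ - ‖y‖) < (ys + s' - τ • (t + s)) (y - τ • v) := by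
    intro y ys s' hy hs'
    have e1 := mul_le_mul_of_nonneg_left (add_le_add (h1 _ hy) (h2 _ hs')) hτ.le
    have e2 := mul_le_mul_of_nonneg_left (hAB y ys s' hy hs') (sub_nonneg.2 hτN)
    have e3 := mul_pos hτ hτδ
    have e4 : 0 ≤ τ * N * (M * ‖y‖) := by positivity
    simp only [add_apply, sub_apply, smul_apply, map_sub, map_smul, smul_eq_mul] at *
    nlinarith
  obtain ⟨z, hz⟩ := hAreg (τ • v) (τ • (t + s)) (M + K) (by
    rintro ⟨y, ys⟩ hy
    obtain ⟨s', hs'⟩ := hBdom y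
    have e1 := key y ys s' hy hs'
    have e2 := (le_abs_self _).trans (s'.le_of_opNorm_le (hBK _ hs') (y - τ • v))
    have e3 := norm_sub_norm_le y (τ • v)
    rw [norm_smul, Real.norm_of_nonneg hτ.le] at e3
    have e4 := mul_le_mul_of_nonneg_left e3 hM
    simp only [add_apply, sub_apply] at *
    linarith)
  -- At `y = τ • v` both sides of `key` vanish.
  obtain ⟨s', hs'⟩ := hBdom (τ • v)
  have := key _ z s' hz hs'
  rw [norm_smul, Real.norm_of_nonneg hτ.le] at this
  simp at this

/-- If the sum of `A` and `B` is related to `(0, 0)` up to the error `M ‖y‖`, then the contribution of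
`B` can be replaced by one functional `s₀` which is monotonically related to `B` at `0`. -/
theorem exists_separating_functional (A B : Set (X × StrongDual ℝ X)) (M K : ℝ) (hM : 0 ≤ M)
    (hA : ∀ p ∈ A, ∀ q ∈ A, 0 ≤ (p.2 - q.2) (p.1 - q.1))
    (hB : ∀ p ∈ B, ∀ q ∈ B, 0 ≤ (p.2 - q.2) (p.1 - q.1))
    (hBK : ∀ p ∈ B, ‖p.2‖ ≤ K) (hBdom : ∀ x, ∃ s, (x, s) ∈ B)
    (hAreg : ∀ x xs C, (∀ p ∈ A, -(C * ‖p.1 - x‖) ≤ (p.2 - xs) (p.1 - x)) → ∃ z, (x, z) ∈ A)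
    (hAB : ∀ y ys s, (y, ys) ∈ A → (y, s) ∈ B → -(M * ‖y‖) ≤ (ys + s) y) :
    ∃ s₀ : StrongDual ℝ X, (∀ p ∈ B, s₀ p.1 ≤ p.2 p.1) ∧
      ∀ p ∈ A, -(M * ‖p.1‖) ≤ (p.2 + s₀) p.1 := by
  obtain ⟨b₀, hb₀⟩ := hBdom 0
  obtain ⟨a₀, ha₀⟩ : ∃ z, ((0 : X), z) ∈ A := by
    refine hAreg 0 0 (M + K) ?_
    rintro ⟨y, ys⟩ hy
    obtain ⟨s, hs⟩ := hBdom y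
    have h1 := hAB y ys s hy hs
    have h2 := (le_abs_self _).trans (s.le_of_opNorm_le (hBK _ hs) y)
    simp only [sub_zero, add_apply] at *
    linarith
  -- The same weight `N` serves for `A` and `B`; points over `0` in the other set make up for it when
  -- a constraint comes from one of them only.
  let C : ConvexCone ℝ (X × ℝ) :=
    { carrier := {z | ∃ (v : X) (t s : StrongDual ℝ X) (α β N : ℝ), 0 < N ∧
        (∀ p ∈ A, t p.1 + p.2 v ≤ α + N * p.2 p.1) ∧
        (∀ p ∈ B, s p.1 + p.2 (v + z.1) ≤ β + N * p.2 p.1) ∧ α + β + M * ‖v‖ ≤ z.2}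
      smul_mem' := by
        rintro c hc z ⟨v, t, s, α, β, N, hN, h1, h2, h3⟩
        refine ⟨c • v, c • t, c • s, c * α, c * β, c * N, mul_pos hc hN, fun p hp => ?_,
          fun p hp => ?_, ?_⟩
        · simp only [smul_apply, map_smul, smul_eq_mul]
          nlinarith [mul_le_mul_of_nonneg_left (h1 p hp) hc.le]
        · simp only [smul_apply, map_smul, smul_eq_mul, Prod.smul_fst, ← smul_add]
          nlinarith [mul_le_mul_of_nonneg_left (h2 p hp) hc.le]
        · rw [norm_smul, Real.norm_of_nonneg hc.le, Prod.smul_snd, smul_eq_mul]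
          nlinarith
      add_mem' := by
        rintro z ⟨v, t, s, α, β, N, hN, h1, h2, h3⟩ z' ⟨v', t', s', α', β', N', hN', h1', h2', h3'⟩
        refine ⟨v + v', t + t', s + s', α + α', β + β', N + N', add_pos hN hN', fun p hp => ?_,
          fun p hp => ?_, ?_⟩
        · have := h1 p hp
          have := h1' p hp
          simp only [add_apply, map_add]
          linarith
        · have := h2 p hp
          have := h2' p hp
          simp only [add_apply, map_add, Prod.fst_add] at *
          linarith
        · rw [Prod.snd_add]
          nlinarith [norm_add_le v v'] }
  have hCB : ∀ p ∈ B, (p.1, p.2 p.1) ∈ C := by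
    intro p hp
    refine ⟨0, a₀, p.2, 0, p.2 p.1, 1, one_pos, fun q hq => ?_, fun q hq => ?_, by simp⟩
    · have := hA q hq _ ha₀
      simp only [sub_apply, sub_zero, map_zero] at *
      linarith
    · have := hB p hp q hq
      simp only [sub_apply, map_sub, zero_add] at *
      linarith
  have hCA : ∀ p ∈ A, (-p.1, p.2 p.1 + M * ‖p.1‖) ∈ C := by
    intro p hp
    refine ⟨p.1, p.2, b₀, p.2 p.1, 0, 1, one_pos, fun q hq => ?_, fun q hq => ?_, by simp⟩
    · have := hA p hp q hq
      simp only [sub_apply, map_sub] at *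
      linarith
    · have := hB q hq _ hb₀
      simp only [sub_apply, sub_zero, add_neg_cancel, map_zero] at *
      linarith
  obtain ⟨f, hf⟩ := exists_linearMap_le_of_convexCone C
    (by
      rintro r ⟨v, t, s, α, β, N, hN, h1, h2, h3⟩
      simp only [add_zero] at h2 h3
      exact (add_add_norm_nonneg_of_related A B M K hM hBK hBdom hAreg hAB hN h1 h2).trans h3)
    (fun d => (hBdom d).elim fun s hs => ⟨_, hCB _ hs⟩)
  obtain ⟨g, hg⟩ := exists_strongDual_of_le_norm f K fun d => by
    obtain ⟨s, hs⟩ := hBdom d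
    exact (hf _ _ (hCB _ hs)).trans
      ((le_abs_self _).trans (s.le_of_opNorm_le (hBK _ hs) d))
  refine ⟨g, fun p hp => (hg _).trans_le (hf _ _ (hCB p hp)), fun p hp => ?_⟩
  have h := hf _ _ (hCA p hp)
  rw [map_neg, ← hg] at h
  rw [add_apply]
  linarith

end Monotone

/-! ### Maximal monotone and regular operators -/

section Operator

variable {X : Type*} [NormedAddCommGroup X] [NormedSpace ℝ X] {T S : X → Set (StrongDual ℝ X)}

/-- A point monotonically related to the graph of a maximal monotone operator belongs to it. -/
theorem IsMaximalMonotoneOp.mem_of_forall_nonneg (hT : IsMaximalMonotoneOp T) {x : X}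
    {xs : StrongDual ℝ X} (h : ∀ y, ∀ ys ∈ T y, 0 ≤ (ys - xs) (y - x)) : xs ∈ T x := by
  by_contra hx
  refine hT.2 ⟨fun y => {ys | ys ∈ T y ∨ (y = x ∧ ys = xs)}, ?_, ?_, ?_⟩
  · rintro ⟨y, ys⟩ (hy | ⟨rfl, rfl⟩) ⟨z, zs⟩ (hz | ⟨rfl, rfl⟩)
    · exact hT.1 (y, ys) hy (z, zs) hz
    · exact h y ys hy
    · have := h z zs hz
      simp only [sub_apply, map_sub] at *
      linarith
    · simp
  · exact fun p hp => Or.inl hp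
  · intro hsub
    exact hx (hsub (a := (x, xs)) (Or.inr ⟨rfl, rfl⟩))

theorem opL_le_ofReal_iff {x : X} {xs : StrongDual ℝ X} {M : ℝ} (hM : 0 ≤ M) :
    opL x xs T ≤ ENNReal.ofReal M ↔
      ∀ y, ∀ ys ∈ T y, -(M * ‖y - x‖) ≤ (ys - xs) (y - x) := by
  have key : ∀ (y : X) (ys : StrongDual ℝ X), y ≠ x →
      (ENNReal.ofReal ((ys - xs) (x - y) / ‖x - y‖) ≤ ENNReal.ofReal M ↔
        -(M * ‖y - x‖) ≤ (ys - xs) (y - x)) := by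
    intro y ys hyx
    rw [ENNReal.ofReal_le_ofReal_iff hM, div_le_iff₀ (norm_sub_pos_iff.2 hyx.symm), norm_sub_rev,
      ← neg_sub y x, map_neg, neg_le]
  simp only [opL, iSup_le_iff]
  constructor
  · intro h y ys hy
    by_cases hyx : y = x
    · simp [hyx]
    · exact (key y ys hyx).1 (h (y, ys) ⟨hy, hyx⟩)
  · rintro h ⟨y, ys⟩ ⟨hy, hyx⟩
    exact (key y ys hyx).2 (h y ys hy)

theorem IsMonotoneOp.opL_le_infEDist (hT : IsMonotoneOp T) (x : X) (xs : StrongDual ℝ X) :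
    opL x xs T ≤ Metric.infEDist xs (T x) := by
  refine Metric.le_infEDist.2 fun t ht => ?_
  rw [edist_dist, dist_eq_norm, opL_le_ofReal_iff (norm_nonneg _)]
  intro y ys hy
  have h1 := hT (y, ys) hy (x, t) ht
  have h2 := (le_abs_self _).trans ((xs - t).le_opNorm (y - x))
  simp only [sub_apply] at *
  linarith

theorem IsRegularOp.nonempty_of_forall_le (hT : IsRegularOp T) {x : X} {xs : StrongDual ℝ X}
    {C : ℝ} (h : ∀ y, ∀ ys ∈ T y, -(C * ‖y - x‖) ≤ (ys - xs) (y - x)) : (T x).Nonempty := by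
  by_contra hx
  have h1 : opL x xs T ≤ ENNReal.ofReal |C| := (opL_le_ofReal_iff (abs_nonneg C)).2
    fun y ys hy => le_trans (by gcongr; exact le_abs_self C) (h y ys hy)
  rw [hT, Set.not_nonempty_iff_eq_empty.1 hx, Metric.infEDist_empty] at h1
  exact absurd h1 (by simp)

/-- A bounded maximal monotone operator has full domain. -/
theorem IsMaximalMonotoneOp.nonempty_of_isBoundedOp (hS : IsMaximalMonotoneOp S)
    (hSb : IsBoundedOp S) (x : X) : (S x).Nonempty := by
  by_cases hne : (opGraph S).Nonempty
  · obtain ⟨K, hK⟩ := hSb.exists_norm_le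
    obtain ⟨s₀, hs₀⟩ := exists_le_of_monotone_of_bounded {p | p.2 ∈ S (p.1 + x)}
      (by
        obtain ⟨⟨y, ys⟩, hy⟩ := hne
        exact ⟨(y - x, ys), by simpa using show ys ∈ S y from hy⟩)
      (fun p hp q hq => by simpa using hS.1 (p.1 + x, p.2) hp (q.1 + x, q.2) hq)
      K (fun p hp => hK _ ⟨_, hp⟩)
    refine ⟨s₀, hS.mem_of_forall_nonneg fun y ys hy => ?_⟩
    exact sub_nonneg.2 (hs₀ (y - x, ys) (by simpa using show ys ∈ S y from hy))
  · exact ⟨0, hS.mem_of_forall_nonneg fun y ys hy => (hne ⟨(y, ys), hy⟩).elim⟩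

/-- A bound `L(x, x*, T + S) ≤ M` yields some `s ∈ S x` with `L(x, x* - s, T) ≤ M`, both bounds being
written as inequalities on the graphs. -/
theorem IsRegularOp.exists_mem_forall_le (hT : IsMaximalMonotoneOp T) (hTr : IsRegularOp T)
    (hS : IsMaximalMonotoneOp S) (hSb : IsBoundedOp S) {x : X} {xs : StrongDual ℝ X} {M : ℝ}
    (hM : 0 ≤ M)
    (h : ∀ y, ∀ z ∈ (T + S) y, -(M * ‖y - x‖) ≤ (z - xs) (y - x)) :
    ∃ s ∈ S x, ∀ y, ∀ ys ∈ T y, -(M * ‖y - x‖) ≤ (ys - (xs - s)) (y - x) := by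
  obtain ⟨K, hK⟩ := hSb.exists_norm_le
  obtain ⟨s₀, h1, h2⟩ := exists_separating_functional
    {p | p.2 + xs ∈ T (p.1 + x)} {p | p.2 ∈ S (p.1 + x)} M K hM
    (fun p hp q hq => by simpa using hT.1 (p.1 + x, p.2 + xs) hp (q.1 + x, q.2 + xs) hq)
    (fun p hp q hq => by simpa using hS.1 (p.1 + x, p.2) hp (q.1 + x, q.2) hq)
    (fun p hp => hK _ ⟨_, hp⟩)
    (fun y => hS.nonempty_of_isBoundedOp hSb (y + x))
    (by
      intro y ys C hC
      obtain ⟨z, hz⟩ := hTr.nonempty_of_forall_le (x := y + x) (xs := ys + xs) (C := C)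
        (fun w ws hw => by
          have := hC (w - x, ws - xs) (by simpa using hw)
          simpa only [sub_sub, add_comm x y, add_comm xs ys] using this)
      exact ⟨z - xs, by simpa using hz⟩)
    (by
      intro y ys s hy hs
      have := h (y + x) (ys + xs + s) (Set.add_mem_add hy hs)
      rwa [add_sub_cancel_right, add_right_comm, add_sub_cancel_right] at this)
  refine ⟨s₀, hS.mem_of_forall_nonneg fun y ys hy => ?_, fun y ys hy => ?_⟩
  · exact sub_nonneg.2 (h1 (y - x, ys) (by simpa using hy))
  · have := h2 (y - x, ys - xs) (by simpa using hy)
    rwa [← sub_add]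

theorem IsMonotoneOp.add (hT : IsMonotoneOp T) (hS : IsMonotoneOp S) : IsMonotoneOp (T + S) := by
  rintro ⟨y, _⟩ ⟨t, ht, s, hs, rfl⟩ ⟨z, _⟩ ⟨t', ht', s', hs', rfl⟩
  have h1 := hT (y, t) ht (z, t') ht'
  have h2 := hS (y, s) hs (z, s') hs'
  simp only [sub_apply, add_apply] at *
  linarith

theorem IsRegularOp.isMaximalMonotoneOp_add (hT : IsMaximalMonotoneOp T) (hTr : IsRegularOp T)
    (hS : IsMaximalMonotoneOp S) (hSb : IsBoundedOp S) : IsMaximalMonotoneOp (T + S) := by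
  refine ⟨hT.1.add hS.1, ?_⟩
  rintro ⟨R, hR, hsub, hne⟩
  refine hne ?_
  rintro ⟨x, xs⟩ hx
  obtain ⟨s, hs, h⟩ := hTr.exists_mem_forall_le hT hS hSb (x := x) (xs := xs) le_rfl
    (fun y z hz => by simpa using hR (y, z) (hsub hz) (x, xs) hx)
  have ht : xs - s ∈ T x := hT.mem_of_forall_nonneg fun y ys hy => by simpa using h y ys hy
  exact ⟨_, ht, s, hs, sub_add_cancel xs s⟩

theorem IsRegularOp.add (hT : IsMaximalMonotoneOp T) (hTr : IsRegularOp T)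
    (hS : IsMaximalMonotoneOp S) (hSb : IsBoundedOp S) : IsRegularOp (T + S) := by
  refine fun x xs => le_antisymm ((hT.1.add hS.1).opL_le_infEDist x xs) ?_
  rcases eq_or_ne (opL x xs (T + S)) ⊤ with htop | htop
  · simp [htop]
  have hle := (ENNReal.ofReal_toReal htop).ge
  obtain ⟨s, hs, h⟩ := hTr.exists_mem_forall_le hT hS hSb ENNReal.toReal_nonneg
    ((opL_le_ofReal_iff ENNReal.toReal_nonneg).1 hle)
  have h1 := (opL_le_ofReal_iff ENNReal.toReal_nonneg).2 h
  rw [hTr, ENNReal.ofReal_toReal htop] at h1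
  refine le_trans ?_ h1
  refine Metric.le_infEDist.2 fun t ht => ?_
  refine (Metric.infEDist_le_edist_of_mem (Set.add_mem_add ht hs)).trans_eq ?_
  rw [edist_dist, edist_dist, dist_eq_norm, dist_eq_norm, sub_sub, add_comm t s]

theorem isMaximalMonotoneOp_const_zero :
    IsMaximalMonotoneOp (fun _ : X => ({0} : Set (StrongDual ℝ X))) := by
  refine ⟨?_, ?_⟩
  · rintro ⟨y, _⟩ rfl ⟨z, _⟩ rfl
    simp
  · rintro ⟨R, hR, hsub, hne⟩
    refine hne ?_
    rintro ⟨x, xs⟩ hx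
    refine ContinuousLinearMap.ext fun d => ?_
    have key : ∀ d, xs d ≤ 0 := fun d => by
      have := hR (x + d, 0) (hsub rfl) (x, xs) hx
      simpa using this
    exact le_antisymm (key d) (by simpa using key (-d))

end Operator

theorem proposition2p5 {X : Type*} [NormedAddCommGroup X] [NormedSpace ℝ X] [CompleteSpace X]
    [Nontrivial X] (T : X → Set (StrongDual ℝ X)) (hT : IsMaximalMonotoneOp T) :
    IsRegularOp T ↔
      ∀ S : X → Set (StrongDual ℝ X), IsMaximalMonotoneOp S → IsBoundedOp S →
        IsMaximalMonotoneOp (T + S) ∧ IsRegularOp (T + S) := by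
  refine ⟨fun hTr S hS hSb =>
    ⟨hTr.isMaximalMonotoneOp_add hT hS hSb, hTr.add hT hS hSb⟩, fun h => ?_⟩
  have hb : IsBoundedOp (fun _ : X => ({0} : Set (StrongDual ℝ X))) :=
    Bornology.isBounded_singleton.subset (by rintro _ ⟨_, hx⟩; exact hx)
  have h0 : (T + fun _ : X => ({0} : Set (StrongDual ℝ X))) = T :=
    funext fun x => by simp
  have := (h _ isMaximalMonotoneOp_const_zero hb).2
  rwa [h0] at this
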